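/- **Proposition 3.14.** Let $(M,g_M,J)$ be a Kähler manifold (an almost Hermitian manifold with $\nabla J=0$, where $\nabla$ is the Levi-Civita connection of $g_M$) and $(N,g_N)$ a Riemannian manifold. Let $F:M\to N$ be a v-semi-slant submersion, i.e. a Riemannian submersion of $M$ onto $N$ together with a distribution $\mathcal D_1\subset(\ker F_*)^\perp$ such that $J(\mathcal D_1)=\mathcal D_1$ and, writing $\mathcal D_2$ for the orthogonal complement of $\mathcal D_1$ in $(\ker F_*)^\perp$, the angle between $JX$ and $(\mathcal D_2)_p$ is the same for all $p\in M$ and all nonzero $X\in(\mathcal D_2)_p$. Let $\mathcal V$, $\mathcal H$, $P$ be the orthogonal projections of $TM$ onto $\ker F_*$, $(\ker F_*)^\perp$ and $\mathcal D_1$. For $X\in\Gamma(\ker F_*)$ put $\phi X=\mathcal V JX$, $\omega X=\mathcal H JX$; for $Z\in\Gamma((\ker F_*)^\perp)$ put $BZ=\mathcal V JZ$, $CZ=\mathcal H JZ$; and put $\mathcal A_EG=\mathcal H\nabla_{\mathcal HE}\mathcal VG+\mathcal V\nabla_{\mathcal HE}\mathcal HG$ for vector fields $E,G$ on $M$. Then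 $\mathcal D_2$ defines a totally geodesic foliation (that is, $[X,Y]\in\Gamma(\mathcal D_2)$ and $\nabla_XY\in\Gamma(\mathcal D_2)$ for all $X,Y\in\Gamma(\mathcal D_2)$) if and only if $$\phi(\mathcal V\nabla_XBY+\mathcal A_XCY)+B(\mathcal A_XBY+\mathcal H\nabla_XCY)=0$$ and $$P\bigl(\omega(\mathcal V\nabla_XBY+\mathcal A_XCY)+C(\mathcal A_XBY+\mathcal H\nabla_XCY)\bigr)=0$$ for all $X,Y\in\Gamma(\mathcal D_2)$. -/

import Mathlib

open Bundle Manifold VectorField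
open scoped ContDiff

/-! ## The Levi-Civita connection -/

section LeviCivita

variable {E : Type*} [NormedAddCommGroup E] [NormedSpace ℝ E]
  {H : Type*} [TopologicalSpace H] {I : ModelWithCorners ℝ E H}
  {M : Type*} [TopologicalSpace M] [ChartedSpace H M]

instance finiteDimensional_tangentSpace [FiniteDimensional ℝ E] (x : M) :
    FiniteDimensional ℝ (TangentSpace I x) :=
  inferInstanceAs (FiniteDimensional ℝ E)

variable [RiemannianBundle (fun x : M => TangentSpace I x)]

/-- The right-hand side of the Koszul formula for `2 g(∇_X Y, Z)`. -/
noncomputable def koszulForm (X Y Z : Π x : M, TangentSpace I x) (x : M) : ℝ :=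
  d% (fun y => inner ℝ (Y y) (Z y)) x (X x) + d% (fun y => inner ℝ (Z y) (X y)) x (Y x)
    - d% (fun y => inner ℝ (X y) (Y y)) x (Z x)
    + inner ℝ (mlieBracket I X Y x) (Z x) - inner ℝ (mlieBracket I X Z x) (Y x)
    - inner ℝ (mlieBracket I Y Z x) (X x)

theorem koszulForm_add_swap (X Y Z : Π x : M, TangentSpace I x) (x : M) :
    koszulForm X Y Z x + koszulForm X Z Y x =
      2 * d% (fun y => inner ℝ (Y y) (Z y)) x (X x) := by
  simp only [koszulForm, real_inner_comm]
  rw [mlieBracket_swap_apply (V := Z) (W := Y)]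
  simp
  ring

theorem koszulForm_sub_swap (X Y Z : Π x : M, TangentSpace I x) (x : M) :
    koszulForm X Y Z x - koszulForm Y X Z x = 2 * inner ℝ (mlieBracket I X Y x) (Z x) := by
  simp only [koszulForm]
  rw [mlieBracket_swap_apply (V := Y) (W := X)]
  simp [real_inner_comm]
  ring

/-- A bilinear form on a Euclidean space is represented by an endomorphism. -/
theorem exists_endomorphism_of_bilin {V : Type*} [NormedAddCommGroup V] [InnerProductSpace ℝ V]
    [FiniteDimensional ℝ V] (B : V → V → ℝ)
    (h1 : ∀ v v' w, B (v + v') w = B v w + B v' w) (h2 : ∀ (c : ℝ) v w, B (c • v) w = c * B v w)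
    (h3 : ∀ v w w', B v (w + w') = B v w + B v w') (h4 : ∀ (c : ℝ) v w, B v (c • w) = c * B v w) :
    ∃ L : V →ₗ[ℝ] V, ∀ v w, inner ℝ (L v) w = B v w := by
  let b := stdOrthonormalBasis ℝ V
  refine ⟨⟨⟨fun v => ∑ i, B v (b i) • b i, ?_⟩, ?_⟩, ?_⟩
  · intro v v'
    simp [h1, add_smul, Finset.sum_add_distrib]
  · intro c v
    simp [h2, mul_smul, Finset.smul_sum]
  · intro v w
    let l : V →ₗ[ℝ] ℝ := ⟨⟨B v, h3 v⟩, fun c w => by simp [h4]⟩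
    have hl : B v w = l w := rfl
    rw [hl]
    conv_rhs => rw [← b.sum_repr w, map_sum]
    simp [sum_inner, inner_smul_left, b.repr_apply_apply, l, mul_comm]

variable [IsManifold I ∞ M] [IsContMDiffRiemannianBundle I ∞ E (fun x : M => TangentSpace I x)]
  {x : M}

theorem mdifferentiableAt_metric {Y Z : Π x : M, TangentSpace I x} (hY : MDiffAt (T% Y) x)
    (hZ : MDiffAt (T% Z) x) : MDiffAt (fun y => inner ℝ (Y y) (Z y)) x :=
  MDifferentiableAt.inner_bundle (F := E) (E := fun x : M => TangentSpace I x) (b := fun x => x)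
    hY hZ

variable [CompleteSpace E]

theorem koszulForm_tensorial_left {Y Z : Π x : M, TangentSpace I x} (hY : MDiffAt (T% Y) x)
    (hZ : MDiffAt (T% Z) x) : TensorialAt I E (fun X => koszulForm X Y Z x) x where
  smul {f X} hf hX := by
    simp [koszulForm, mvfderiv_fun_mul hf (mdifferentiableAt_metric hY hX),
      mvfderiv_fun_mul hf (mdifferentiableAt_metric hZ hX), inner_add_left, inner_smul_left,
      inner_smul_right, mlieBracket_smul_left hf hX, real_inner_comm]
    ring
  add {X X'} hX hX' := by
    simp [koszulForm, mvfderiv_fun_add (mdifferentiableAt_metric hX hY)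
      (mdifferentiableAt_metric hX' hY), mvfderiv_fun_add (mdifferentiableAt_metric hZ hX)
      (mdifferentiableAt_metric hZ hX'), inner_add_left, inner_add_right,
      mlieBracket_add_left hX hX']
    ring

theorem koszulForm_tensorial_right {X Y : Π x : M, TangentSpace I x} (hX : MDiffAt (T% X) x)
    (hY : MDiffAt (T% Y) x) : TensorialAt I E (fun Z => koszulForm X Y Z x) x where
  smul {f Z} hf hZ := by
    simp [koszulForm, mvfderiv_fun_mul hf (mdifferentiableAt_metric hY hZ),
      mvfderiv_fun_mul hf (mdifferentiableAt_metric hX hZ), inner_add_left, inner_smul_left,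
      inner_smul_right, mlieBracket_smul_right hf hZ, real_inner_comm]
    ring
  add {Z Z'} hZ hZ' := by
    simp [koszulForm, mvfderiv_fun_add (mdifferentiableAt_metric hZ hX)
      (mdifferentiableAt_metric hZ' hX), mvfderiv_fun_add (mdifferentiableAt_metric hY hZ)
      (mdifferentiableAt_metric hY hZ'), inner_add_left, inner_add_right,
      mlieBracket_add_right hZ hZ']
    ring

theorem koszulForm_smul_middle {X Y Z : Π x : M, TangentSpace I x} {f : M → ℝ}
    (hf : MDiffAt f x) (hX : MDiffAt (T% X) x) (hY : MDiffAt (T% Y) x) (hZ : MDiffAt (T% Z) x) :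
    koszulForm X (f • Y) Z x =
      f x * koszulForm X Y Z x + 2 * (d% f x (X x) * inner ℝ (Y x) (Z x)) := by
  simp [koszulForm, mvfderiv_fun_mul hf (mdifferentiableAt_metric hY hZ),
    mvfderiv_fun_mul hf (mdifferentiableAt_metric hX hY), inner_add_left, inner_smul_left,
    inner_smul_right, mlieBracket_smul_left hf hY, mlieBracket_smul_right hf hY, real_inner_comm]
  ring

theorem koszulForm_add_middle {X Y Y' Z : Π x : M, TangentSpace I x} (hX : MDiffAt (T% X) x)
    (hY : MDiffAt (T% Y) x) (hY' : MDiffAt (T% Y') x) (hZ : MDiffAt (T% Z) x) :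
    koszulForm X (Y + Y') Z x = koszulForm X Y Z x + koszulForm X Y' Z x := by
  simp [koszulForm, mvfderiv_fun_add (mdifferentiableAt_metric hY hZ)
    (mdifferentiableAt_metric hY' hZ), mvfderiv_fun_add (mdifferentiableAt_metric hX hY)
    (mdifferentiableAt_metric hX hY'), inner_add_left, inner_add_right,
    mlieBracket_add_left hY hY', mlieBracket_add_right hY hY']
  ring

variable (I M) in
/-- Existence of a torsion-free metric connection on a Riemannian manifold. -/
theorem exists_leviCivita [FiniteDimensional ℝ E] :
    ∃ cov : CovariantDerivative I E (fun x : M => TangentSpace I x),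
      (∀ (X Y : Π x : M, TangentSpace I x) (x : M), MDiffAt (T% X) x → MDiffAt (T% Y) x →
        cov Y x (X x) - cov X x (Y x) = mlieBracket I X Y x) ∧
      (∀ (X Y Z : Π x : M, TangentSpace I x) (x : M),
        MDiffAt (T% X) x → MDiffAt (T% Y) x → MDiffAt (T% Z) x →
        d% (fun y => inner ℝ (Y y) (Z y)) x (X x) =
          inner ℝ (cov Y x (X x)) (Z x) + inner ℝ (Y x) (cov Z x (X x))) := by
  have key : ∀ (Y : Π x : M, TangentSpace I x) (x : M),
      ∃ L : TangentSpace I x →L[ℝ] TangentSpace I x, MDiffAt (T% Y) x →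
        ∀ X Z : Π x : M, TangentSpace I x, MDiffAt (T% X) x → MDiffAt (T% Z) x →
          2 * inner ℝ (L (X x)) (Z x) = koszulForm X Y Z x := by
    intro Y x
    by_cases hY : MDiffAt (T% Y) x
    swap
    · exact ⟨0, fun h => absurd h hY⟩
    let B := TensorialAt.mkHom₂ (I := I) (F := E) (F' := E) (fun X Z => koszulForm X Y Z x) x
      (fun Z hZ => koszulForm_tensorial_left hY hZ) (fun X hX => koszulForm_tensorial_right hX hY)
    obtain ⟨L, hL⟩ := exists_endomorphism_of_bilin (V := TangentSpace I x) (fun v w => B v w / 2)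
      (fun v v' w => by simp [add_div]) (fun c v w => by simp [mul_div_assoc])
      (fun v v' w => by simp [add_div]) (fun c v w => by simp [mul_div_assoc])
    refine ⟨LinearMap.toContinuousLinearMap (E := TangentSpace I x) L, fun _ X Z hX hZ => ?_⟩
    have h1 : B (X x) (Z x) = koszulForm X Y Z x := TensorialAt.mkHom₂_apply _ _ hX hZ
    have h2 : inner ℝ (L (X x)) (Z x) = B (X x) (Z x) / 2 := hL _ _
    rw [← h1]
    change 2 * inner ℝ (L (X x)) (Z x) = _
    rw [h2]
    ring
  choose cov hcov using key
  have vec : ∀ (x : M) (u u' : TangentSpace I x),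
      (∀ Z : Π x : M, TangentSpace I x, MDiffAt (T% Z) x →
        2 * (inner ℝ u (Z x) : ℝ) = 2 * inner ℝ u' (Z x)) → u = u' := by
    intro x u u' h
    refine ext_inner_right ℝ fun w => ?_
    have := h (FiberBundle.extend E w) (FiberBundle.mdifferentiableAt_extend ..)
    simpa using this
  have hom : ∀ (x : M) (L L' : TangentSpace I x →L[ℝ] TangentSpace I x),
      (∀ X : Π x : M, TangentSpace I x, MDiffAt (T% X) x → L (X x) = L' (X x)) → L = L' := by
    intro x L L' h
    ext v
    have := h (FiberBundle.extend E v) (FiberBundle.mdifferentiableAt_extend ..)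
    simpa using this
  refine ⟨⟨cov, ⟨?_, ?_⟩⟩, ?_, ?_⟩
  · intro Y Y' x hY hY' _
    refine hom _ _ _ fun X hX => vec _ _ _ fun Z hZ => ?_
    rw [hcov _ _ (mdifferentiableAt_add_section hY hY') X Z hX hZ,
      koszulForm_add_middle hX hY hY' hZ, ← hcov _ _ hY X Z hX hZ, ← hcov _ _ hY' X Z hX hZ]
    change _ = 2 * inner ℝ (cov Y x (X x) + cov Y' x (X x)) (Z x)
    rw [inner_add_left]
    ring
  · intro Y f x hY hf _
    refine hom _ _ _ fun X hX => vec _ _ _ fun Z hZ => ?_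
    rw [hcov _ _ (hf.smul_section hY) X Z hX hZ,
      koszulForm_smul_middle hf hX hY hZ, ← hcov _ _ hY X Z hX hZ]
    change _ = 2 * inner ℝ (f x • cov Y x (X x) + d% f x (X x) • Y x) (Z x)
    rw [inner_add_left, real_inner_smul_left, real_inner_smul_left]
    ring
  · intro X Y x hX hY
    refine vec _ _ _ fun Z hZ => ?_
    change 2 * inner ℝ (cov Y x (X x) - cov X x (Y x)) (Z x) = _
    rw [inner_sub_left, mul_sub, hcov _ _ hY X Z hX hZ, hcov _ _ hX Y Z hY hZ,
      koszulForm_sub_swap]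
  · intro X Y Z x hX hY hZ
    change _ = inner ℝ (cov Y x (X x)) (Z x) + inner ℝ (Y x) (cov Z x (X x))
    rw [real_inner_comm (cov Z x (X x)) (Y x)]
    have h1 := hcov _ _ hY X Z hX hZ
    have h2 := hcov _ _ hZ X Y hX hY
    have h3 := koszulForm_add_swap X Y Z x
    linarith

end LeviCivita

section Geometry

variable {E : Type*} [NormedAddCommGroup E] [NormedSpace ℝ E] [FiniteDimensional ℝ E]
  {H : Type*} [TopologicalSpace H] {I : ModelWithCorners ℝ E H}
  {M : Type*} [TopologicalSpace M] [ChartedSpace H M] [IsManifold I ∞ M]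
  [RiemannianBundle (fun x : M => TangentSpace I x)]
  [IsContMDiffRiemannianBundle I ∞ E (fun x : M => TangentSpace I x)]

variable (I M) in
/-- The Levi-Civita connection: the torsion-free metric connection on the tangent bundle
(these two properties determine it on all differentiable vector fields). -/
noncomputable def leviCivita : CovariantDerivative I E (fun x : M => TangentSpace I x) :=
  haveI : CompleteSpace E := FiniteDimensional.complete ℝ E
  (exists_leviCivita I M).choose

theorem leviCivita_torsion_free (X Y : Π x : M, TangentSpace I x) (x : M)
    (hX : MDiffAt (T% X) x) (hY : MDiffAt (T% Y) x) :
    leviCivita I M Y x (X x) - leviCivita I M X x (Y x) = mlieBracket I X Y x :=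
  haveI : CompleteSpace E := FiniteDimensional.complete ℝ E
  (exists_leviCivita I M).choose_spec.1 X Y x hX hY

theorem leviCivita_metric (X Y Z : Π x : M, TangentSpace I x) (x : M)
    (hX : MDiffAt (T% X) x) (hY : MDiffAt (T% Y) x) (hZ : MDiffAt (T% Z) x) :
    d% (fun y => inner ℝ (Y y) (Z y)) x (X x) =
      inner ℝ (leviCivita I M Y x (X x)) (Z x) + inner ℝ (Y x) (leviCivita I M Z x (X x)) :=
  haveI : CompleteSpace E := FiniteDimensional.complete ℝ E
  (exists_leviCivita I M).choose_spec.2 X Y Z x hX hY hZ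

/-- `nabla X Y` is the vector field `∇_X Y`. -/
noncomputable def nabla (X Y : Π x : M, TangentSpace I x) : Π x : M, TangentSpace I x :=
  fun x => leviCivita I M Y x (X x)

/-! ## Distributions -/

/-- `D` is a smooth distribution, i.e. a smooth vector subbundle of the tangent bundle: near every
point it is spanned by a smooth local frame. -/
def IsSmoothDistribution (D : Π x : M, Submodule ℝ (TangentSpace I x)) : Prop :=
  ∀ x₀ : M, ∃ (k : ℕ) (U : Set M) (s : Fin k → Π x : M, TangentSpace I x),
    IsOpen U ∧ x₀ ∈ U ∧ (∀ i, CMDiff[U] ∞ (T% (s i))) ∧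
      ∀ x ∈ U, LinearIndependent ℝ (fun i => s i x) ∧
        Submodule.span ℝ (Set.range fun i => s i x) = D x

/-- `X ∈ Γ(D)`: `X` is a smooth vector field on `M` with values in `D`. -/
def IsSectionOf (D : Π x : M, Submodule ℝ (TangentSpace I x))
    (X : Π x : M, TangentSpace I x) : Prop :=
  CMDiff ∞ (T% X) ∧ ∀ x, X x ∈ D x

/-- The distribution `D` defines a totally geodesic foliation: it is involutive, so that it is
tangent to a foliation, and the leaves are totally geodesic, i.e. `∇_X Y` is tangent to the leaves
whenever the vector fields `X` and `Y` are. -/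
structure DefinesTotallyGeodesicFoliation
    (D : Π x : M, Submodule ℝ (TangentSpace I x)) : Prop where
  involutive : ∀ X Y : Π x : M, TangentSpace I x, IsSectionOf D X → IsSectionOf D Y →
    ∀ x, mlieBracket I X Y x ∈ D x
  totallyGeodesic : ∀ X Y : Π x : M, TangentSpace I x, IsSectionOf D X → IsSectionOf D Y →
    ∀ x, nabla X Y x ∈ D x

/-- The pointwise orthogonal projection of a vector field onto a distribution. -/
noncomputable def projOnto (D : Π x : M, Submodule ℝ (TangentSpace I x))
    (X : Π x : M, TangentSpace I x) : Π x : M, TangentSpace I x :=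
  fun x => (D x).starProjection (X x)

/-! ## Almost Hermitian and Kähler structures -/

/-- The vector field `JX`. -/
noncomputable def applyJ (J : Π x : M, TangentSpace I x →L[ℝ] TangentSpace I x)
    (X : Π x : M, TangentSpace I x) : Π x : M, TangentSpace I x :=
  fun x => J x (X x)

/-- `J` is a smooth almost complex structure on the Riemannian manifold `M` for which the metric is
Hermitian. -/
structure IsAlmostHermitian (J : Π x : M, TangentSpace I x →L[ℝ] TangentSpace I x) : Prop where
  contMDiff : ContMDiff I (I.prod 𝓘(ℝ, E →L[ℝ] E)) ∞
    (fun x => TotalSpace.mk' (E →L[ℝ] E)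
      (E := fun x : M => TangentSpace I x →L[ℝ] TangentSpace I x) x (J x))
  apply_apply : ∀ (x : M) (v : TangentSpace I x), J x (J x v) = -v
  inner_apply : ∀ (x : M) (v w : TangentSpace I x), inner ℝ (J x v) (J x w) = inner ℝ v w

/-- `(M, g, J)` is a Kähler manifold: it is almost Hermitian and `∇J = 0`. -/
structure IsKahler (J : Π x : M, TangentSpace I x →L[ℝ] TangentSpace I x) : Prop
    extends IsAlmostHermitian J where
  parallel : ∀ X Y : Π x : M, TangentSpace I x, CMDiff ∞ (T% X) → CMDiff ∞ (T% Y) →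
    nabla X (applyJ J Y) = applyJ J (nabla X Y)

/-! ## Riemannian and v-semi-slant submersions -/

variable {E' : Type*} [NormedAddCommGroup E'] [NormedSpace ℝ E']
  {H' : Type*} [TopologicalSpace H'] {I' : ModelWithCorners ℝ E' H'}
  {N : Type*} [TopologicalSpace N] [ChartedSpace H' N]

variable (I I') in
/-- The vertical distribution `ker F_*`. -/
noncomputable def vertical (F : M → N) (x : M) : Submodule ℝ (TangentSpace I x) :=
  LinearMap.ker (mfderiv I I' F x).toLinearMap

variable (I I') in
/-- The horizontal distribution `(ker F_*)^⊥`. -/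
noncomputable def horizontal (F : M → N) (x : M) : Submodule ℝ (TangentSpace I x) :=
  (vertical I I' F x)ᗮ

variable (I I') in
/-- `F` is a Riemannian submersion of `M` onto `N`. -/
structure IsRiemannianSubmersion [RiemannianBundle (fun y : N => TangentSpace I' y)]
    (F : M → N) : Prop where
  contMDiff : ContMDiff I I' ∞ F
  surjective : Function.Surjective F
  mfderiv_surjective : ∀ x, Function.Surjective (mfderiv I I' F x)
  norm_mfderiv : ∀ x, ∀ v ∈ horizontal I I' F x, ‖mfderiv I I' F x v‖ = ‖v‖

variable (I I') in
/-- The orthogonal complement `D₂` of `D₁` in `(ker F_*)^⊥`. -/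
noncomputable def slantDistribution (F : M → N) (D₁ : Π x : M, Submodule ℝ (TangentSpace I x)) (x : M) :
    Submodule ℝ (TangentSpace I x) :=
  (D₁ x)ᗮ ⊓ horizontal I I' F x

variable (I I') in
/-- `F` is a v-semi-slant submersion, with complex distribution `D₁`. The angle between `JX` and
`(D₂)_p` is the angle between `JX` and its orthogonal projection onto `(D₂)_p`; it is `π / 2` if this
projection is zero. -/
structure IsVSemiSlantSubmersion [RiemannianBundle (fun y : N => TangentSpace I' y)]
    (F : M → N) (J : Π x : M, TangentSpace I x →L[ℝ] TangentSpace I x)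
    (D₁ : Π x : M, Submodule ℝ (TangentSpace I x)) : Prop
    extends IsRiemannianSubmersion I I' F where
  isSmoothDistribution : IsSmoothDistribution D₁
  le_horizontal : ∀ x, D₁ x ≤ horizontal I I' F x
  map_eq : ∀ x, (D₁ x).map (J x).toLinearMap = D₁ x
  slant : ∃ θ : ℝ, ∀ x, ∀ v ∈ slantDistribution I I' F D₁ x, v ≠ 0 →
    InnerProductGeometry.angle (J x v)
      ((slantDistribution I I' F D₁ x).starProjection (J x v)) = θ

section Operators

variable (I I') (F : M → N) (J : Π x : M, TangentSpace I x →L[ℝ] TangentSpace I x)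

/-- The vertical part `𝒱X` of a vector field. -/
noncomputable def vertPart (X : Π x : M, TangentSpace I x) : Π x : M, TangentSpace I x :=
  projOnto (vertical I I' F) X

/-- The horizontal part `ℋX` of a vector field. -/
noncomputable def horPart (X : Π x : M, TangentSpace I x) : Π x : M, TangentSpace I x :=
  projOnto (horizontal I I' F) X

/-- `φX`, the vertical part of `JX` for vertical `X` (extended by zero to horizontal fields). -/
noncomputable def phiOp (X : Π x : M, TangentSpace I x) : Π x : M, TangentSpace I x :=
  vertPart I I' F (applyJ J (vertPart I I' F X))

/-- `ωX`, the horizontal part of `JX` for vertical `X` (extended by zero to horizontal fields). -/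
noncomputable def omegaOp (X : Π x : M, TangentSpace I x) : Π x : M, TangentSpace I x :=
  horPart I I' F (applyJ J (vertPart I I' F X))

/-- `BZ`, the vertical part of `JZ` for horizontal `Z` (extended by zero to vertical fields). -/
noncomputable def bOp (Z : Π x : M, TangentSpace I x) : Π x : M, TangentSpace I x :=
  vertPart I I' F (applyJ J (horPart I I' F Z))

/-- `CZ`, the horizontal part of `JZ` for horizontal `Z` (extended by zero to vertical fields). -/
noncomputable def cOp (Z : Π x : M, TangentSpace I x) : Π x : M, TangentSpace I x :=
  horPart I I' F (applyJ J (horPart I I' F Z))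

/-- O'Neill's tensor `𝒜_X Y = ℋ∇_{ℋX} 𝒱Y + 𝒱∇_{ℋX} ℋY`. -/
noncomputable def oneillA (X Y : Π x : M, TangentSpace I x) : Π x : M, TangentSpace I x :=
  horPart I I' F (nabla (horPart I I' F X) (vertPart I I' F Y)) +
    vertPart I I' F (nabla (horPart I I' F X) (horPart I I' F Y))

end Operators

end Geometry

theorem Matrix.differentiableAt_inv_mulVec {ι : Type*} [Fintype ι] [DecidableEq ι]
    {A : ι → ι → ℝ} (l : ι → ℝ) (hA : (Matrix.of A).det ≠ 0) (i : ι) :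
    DifferentiableAt ℝ (fun p : (ι → ι → ℝ) × (ι → ℝ) => ((Matrix.of p.1)⁻¹.mulVec p.2) i)
      (A, l) := by
  have hdet : Differentiable ℝ
      fun p : (ι → ι → ℝ) × (ι → ℝ) => (Matrix.of p.1).det := by
    simp only [Matrix.det_apply, Matrix.of_apply]
    fun_prop
  have hadj : ∀ j, Differentiable ℝ
      fun p : (ι → ι → ℝ) × (ι → ℝ) => (Matrix.of p.1).adjugate i j := by
    intro j
    simp only [Matrix.adjugate_apply, Matrix.det_apply, Matrix.updateRow_apply, Matrix.of_apply]
    have hentry : ∀ (σ : Equiv.Perm ι) (k : ι), Differentiable ℝ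
        fun p : (ι → ι → ℝ) × (ι → ℝ) =>
          if σ k = j then (Pi.single i 1 : ι → ℝ) k else p.1 (σ k) k := by
      intro σ k
      split_ifs <;> fun_prop
    fun_prop
  simp only [Matrix.inv_def, Matrix.mulVec, dotProduct, Matrix.smul_apply, Ring.inverse_eq_inv',
    smul_eq_mul]
  refine DifferentiableAt.fun_sum fun j _ => ?_
  exact (((hdet _).inv hA).mul (hadj j _)).mul (by fun_prop)

section

variable {E : Type*} [NormedAddCommGroup E] [NormedSpace ℝ E]
  {H : Type*} [TopologicalSpace H] {I : ModelWithCorners ℝ E H}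
  {M : Type*} [TopologicalSpace M] [ChartedSpace H M]

theorem IsAlmostHermitian.contMDiff_applyJ [IsManifold I ∞ M]
    [RiemannianBundle (fun x : M => TangentSpace I x)]
    {J : Π x : M, TangentSpace I x →L[ℝ] TangentSpace I x}
    (hJ : IsAlmostHermitian J) {X : Π x : M, TangentSpace I x} (hX : CMDiff ∞ (T% X)) :
    CMDiff ∞ (T% (applyJ J X)) :=
  ContMDiff.clm_bundle_apply (F₁ := E) (F₂ := E) hJ.contMDiff hX

/-- A map into a finite product of normed spaces is differentiable if its components are. -/
theorem mdifferentiableAt_pi {ι : Type*} [Fintype ι] {G : ι → Type*}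
    [∀ i, NormedAddCommGroup (G i)] [∀ i, NormedSpace ℝ (G i)] {f : M → ∀ i, G i} {x : M}
    (h : ∀ i, MDifferentiableAt I 𝓘(ℝ, G i) (fun y => f y i) x) :
    MDifferentiableAt I 𝓘(ℝ, ∀ i, G i) f x :=
  (mdifferentiableAt_iff _ _).2 ⟨continuousAt_pi.2 fun i => (h i).continuousAt,
    differentiableWithinAt_pi.2 fun i => ((mdifferentiableAt_iff _ _).1 (h i)).2⟩

theorem MDifferentiableAt.matrix_inv_mulVec {ι : Type*} [Fintype ι] [DecidableEq ι]
    {A : M → ι → ι → ℝ} {l : M → ι → ℝ} {x : M}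
    (hA : ∀ i j, MDifferentiableAt I 𝓘(ℝ, ℝ) (fun y => A y i j) x)
    (hl : ∀ i, MDifferentiableAt I 𝓘(ℝ, ℝ) (fun y => l y i) x)
    (hdet : (Matrix.of (A x)).det ≠ 0) (i : ι) :
    MDifferentiableAt I 𝓘(ℝ, ℝ) (fun y => ((Matrix.of (A y))⁻¹.mulVec (l y)) i) x := by
  have hpair : MDifferentiableAt I 𝓘(ℝ, (ι → ι → ℝ) × (ι → ℝ)) (fun y => (A y, l y)) x :=
    MDifferentiableAt.prodMk_space
      (mdifferentiableAt_pi fun j => mdifferentiableAt_pi fun k => hA j k)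
      (mdifferentiableAt_pi hl)
  have hinv := Matrix.differentiableAt_inv_mulVec (l x) hdet i
  have hcomp := DifferentiableAt.comp_mdifferentiableAt (f := fun y => (A y, l y)) hinv hpair
  exact hcomp

theorem applyJ_add (J : Π x : M, TangentSpace I x →L[ℝ] TangentSpace I x)
    (X Y : Π x : M, TangentSpace I x) : applyJ J (X + Y) = applyJ J X + applyJ J Y :=
  funext fun x => map_add (J x) (X x) (Y x)

variable [FiniteDimensional ℝ E] [RiemannianBundle (fun x : M => TangentSpace I x)]

variable {E' : Type*} [NormedAddCommGroup E'] [NormedSpace ℝ E']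
  {H' : Type*} [TopologicalSpace H'] {I' : ModelWithCorners ℝ E' H'}
  {N : Type*} [TopologicalSpace N] [ChartedSpace H' N]

theorem vertPart_add_horPart (F : M → N) (X : Π x : M, TangentSpace I x) :
    vertPart I I' F X + horPart I I' F X = X := by
  funext x
  exact (vertical I I' F x).starProjection_add_starProjection_orthogonal (X x)

theorem vertPart_mem (F : M → N) (X : Π x : M, TangentSpace I x) (x : M) :
    vertPart I I' F X x ∈ vertical I I' F x :=
  (vertical I I' F x).starProjection_apply_mem (X x)

theorem horPart_mem (F : M → N) (X : Π x : M, TangentSpace I x) (x : M) :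
    horPart I I' F X x ∈ horizontal I I' F x :=
  (horizontal I I' F x).starProjection_apply_mem (X x)

theorem horPart_eq_self {F : M → N} {X : Π x : M, TangentSpace I x}
    (hX : ∀ x, X x ∈ horizontal I I' F x) : horPart I I' F X = X :=
  funext fun x => Submodule.starProjection_eq_self_iff.2 (hX x)

theorem vertPart_eq_self {F : M → N} {X : Π x : M, TangentSpace I x}
    (hX : ∀ x, X x ∈ vertical I I' F x) : vertPart I I' F X = X :=
  funext fun x => Submodule.starProjection_eq_self_iff.2 (hX x)

theorem horPart_eq_zero {F : M → N} {X : Π x : M, TangentSpace I x}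
    (hX : ∀ x, X x ∈ vertical I I' F x) : horPart I I' F X = 0 := by
  simpa [vertPart_eq_self hX] using vertPart_add_horPart (I' := I') F X

theorem vertPart_eq_zero {F : M → N} {X : Π x : M, TangentSpace I x}
    (hX : ∀ x, X x ∈ horizontal I I' F x) : vertPart I I' F X = 0 := by
  simpa [horPart_eq_self hX] using vertPart_add_horPart (I' := I') F X

theorem projOnto_add (D : Π x : M, Submodule ℝ (TangentSpace I x))
    (X Y : Π x : M, TangentSpace I x) :
    projOnto D (X + Y) = projOnto D X + projOnto D Y :=
  funext fun x => map_add (D x).starProjection (X x) (Y x)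

theorem projOnto_neg (D : Π x : M, Submodule ℝ (TangentSpace I x))
    (X : Π x : M, TangentSpace I x) : projOnto D (-X) = -projOnto D X :=
  funext fun x => map_neg (D x).starProjection (X x)

theorem vertPart_add (F : M → N) (X Y : Π x : M, TangentSpace I x) :
    vertPart I I' F (X + Y) = vertPart I I' F X + vertPart I I' F Y :=
  projOnto_add _ X Y

theorem horPart_add (F : M → N) (X Y : Π x : M, TangentSpace I x) :
    horPart I I' F (X + Y) = horPart I I' F X + horPart I I' F Y :=
  projOnto_add _ X Y

theorem phiOp_add_bOp (F : M → N) (J : Π x : M, TangentSpace I x →L[ℝ] TangentSpace I x)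
    (Z : Π x : M, TangentSpace I x) :
    phiOp I I' F J (vertPart I I' F Z) + bOp I I' F J (horPart I I' F Z) =
      vertPart I I' F (applyJ J Z) := by
  rw [phiOp, bOp, vertPart_eq_self (vertPart_mem F Z), horPart_eq_self (horPart_mem F Z),
    ← vertPart_add, ← applyJ_add, vertPart_add_horPart]

theorem omegaOp_add_cOp (F : M → N) (J : Π x : M, TangentSpace I x →L[ℝ] TangentSpace I x)
    (Z : Π x : M, TangentSpace I x) :
    omegaOp I I' F J (vertPart I I' F Z) + cOp I I' F J (horPart I I' F Z) =
      horPart I I' F (applyJ J Z) := by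
  rw [omegaOp, cOp, vertPart_eq_self (vertPart_mem F Z), horPart_eq_self (horPart_mem F Z),
    ← horPart_add, ← applyJ_add, vertPart_add_horPart]

theorem projOnto_horPart {F : M → N} {D : Π x : M, Submodule ℝ (TangentSpace I x)}
    (hD : ∀ x, D x ≤ horizontal I I' F x) (X : Π x : M, TangentSpace I x) :
    projOnto D (horPart I I' F X) = projOnto D X := by
  have h : projOnto D (vertPart I I' F X) = 0 := by
    funext x
    refine (Submodule.starProjection_apply_eq_zero_iff _).2 fun v hv => ?_
    exact Submodule.inner_left_of_mem_orthogonal (vertPart_mem (I' := I') F X x) (hD x hv)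
  conv_rhs => rw [← vertPart_add_horPart (I' := I') F X, projOnto_add, h, zero_add]

theorem mem_slantDistribution_iff {F : M → N} {D : Π x : M, Submodule ℝ (TangentSpace I x)}
    (X : Π x : M, TangentSpace I x) :
    (∀ x, X x ∈ slantDistribution I I' F D x) ↔ vertPart I I' F X = 0 ∧ projOnto D X = 0 := by
  simp only [funext_iff, vertPart, projOnto, Pi.zero_apply,
    Submodule.starProjection_apply_eq_zero_iff, slantDistribution, Submodule.mem_inf, horizontal,
    forall_and, and_comm]

theorem IsRiemannianSubmersion.inner_horPart
    [RiemannianBundle (fun y : N => TangentSpace I' y)] {F : M → N} (hF : IsRiemannianSubmersion I I' F)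
    (X Y : Π x : M, TangentSpace I x) (x : M) :
    inner ℝ (Y x) (horPart I I' F X x) =
      inner ℝ (mfderiv I I' F x (Y x)) (mfderiv I I' F x (X x)) := by
  have hpart : ∀ Z : Π x : M, TangentSpace I x,
      mfderiv I I' F x (Z x) = mfderiv I I' F x (horPart I I' F Z x) := by
    intro Z
    have h0 : mfderiv I I' F x (vertPart I I' F Z x) = 0 := vertPart_mem F Z x
    have h1 : Z x = vertPart I I' F Z x + horPart I I' F Z x :=
      (congrFun (vertPart_add_horPart (I' := I') F Z) x).symm
    rw [h1, map_add, h0, zero_add]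
  have h2 : inner ℝ (vertPart I I' F Y x) (horPart I I' F X x) = (0 : ℝ) :=
    Submodule.inner_right_of_mem_orthogonal (vertPart_mem F Y x) (horPart_mem F X x)
  have h3 : Y x = vertPart I I' F Y x + horPart I I' F Y x :=
    (congrFun (vertPart_add_horPart (I' := I') F Y) x).symm
  let L : horizontal I I' F x →ₗᵢ[ℝ] TangentSpace I' (F x) :=
    ⟨(mfderiv I I' F x).toLinearMap.comp (horizontal I I' F x).subtype,
      fun v => hF.norm_mfderiv x v v.2⟩
  have h4 := L.inner_map_map ⟨_, horPart_mem F Y x⟩ ⟨_, horPart_mem F X x⟩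
  rw [hpart X, hpart Y]
  refine Eq.trans ?_ h4.symm
  conv_lhs => rw [h3]
  rw [inner_add_left, h2, zero_add]
  rfl

variable [IsManifold I ∞ M] [IsContMDiffRiemannianBundle I ∞ E (fun x : M => TangentSpace I x)]

/-- A vector field is differentiable at a point as soon as its inner products with all
differentiable vector fields are. -/
theorem mdifferentiableAt_of_inner {U : Π x : M, TangentSpace I x} {x : M}
    (h : ∀ W : Π x : M, TangentSpace I x, MDiffAt (T% W) x →
      MDiffAt (fun y => inner ℝ (W y) (U y) : M → ℝ) x) : MDiffAt (T% U) x := by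
  classical
  let ι := Fin (Module.finrank ℝ E)
  let b : Module.Basis ι ℝ E := Module.finBasis ℝ E
  let e := trivializationAt E (TangentSpace I : M → Type _) x
  have hx : x ∈ e.baseSet := FiberBundle.mem_baseSet_trivializationAt' x
  have hnhds : e.baseSet ∈ nhds x := e.open_baseSet.mem_nhds hx
  let s := e.localFrame b
  have hs : IsLocalFrameOn I E 1 s e.baseSet := e.isLocalFrameOn_localFrame_baseSet I 1 b
  have hsd : ∀ i, MDiffAt (T% (s i)) x := fun i =>
    (hs.contMDiffAt e.open_baseSet hx i).mdifferentiableAt one_ne_zero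
  have hdet : ∀ y ∈ e.baseSet, (Matrix.gram ℝ fun i => s i y).det ≠ 0 := fun y hy =>
    Matrix.det_gram_ne_zero_iff_linearIndependent.2 (hs.linearIndependent hy)
  refine hs.mdifferentiableAt_of_coeff (fun i => ?_) hnhds
  have hcoeff : (LinearMap.piApply (hs.coeff i)) U =ᶠ[nhds x]
      fun y => ((Matrix.of fun j k => inner ℝ (s j y) (s k y))⁻¹.mulVec
        fun j => inner ℝ (s j y) (U y)) i := by
    filter_upwards [hnhds] with y hy
    have hsum : ∀ j, inner ℝ (s j y) (U y) =
        ((Matrix.gram ℝ fun i => s i y).mulVec fun k => hs.coeff k y (U y)) j := by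
      intro j
      conv_lhs => rw [hs.coeff_sum_eq U hy]
      simp [Matrix.mulVec, dotProduct, inner_sum, inner_smul_right, mul_comm]
    simp only [hsum]
    change _ = ((Matrix.gram ℝ fun i => s i y)⁻¹.mulVec
      ((Matrix.gram ℝ fun i => s i y).mulVec fun k => hs.coeff k y (U y))) i
    rw [Matrix.mulVec_mulVec, Matrix.nonsing_inv_mul _ (hdet y hy).isUnit, Matrix.one_mulVec]
    rfl
  refine MDifferentiableAt.congr_of_eventuallyEq ?_ hcoeff
  exact MDifferentiableAt.matrix_inv_mulVec
    (fun j k => mdifferentiableAt_metric (hsd j) (hsd k)) (fun j => h _ (hsd j)) (hdet x hx) i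

theorem nabla_zero (X : Π x : M, TangentSpace I x) : nabla X 0 = 0 := by
  funext x
  have := (leviCivita I M).isCovariantDerivativeOnUniv.zero (x := x)
  exact congrArg (fun L : TangentSpace I x →L[ℝ] TangentSpace I x => L (X x)) this

theorem nabla_add (X : Π x : M, TangentSpace I x) {Y Z : Π x : M, TangentSpace I x}
    (hY : MDiff (T% Y)) (hZ : MDiff (T% Z)) : nabla X (Y + Z) = nabla X Y + nabla X Z := by
  funext x
  have := (leviCivita I M).isCovariantDerivativeOnUniv.add (x := x) (hY x) (hZ x)
  exact congrArg (fun L : TangentSpace I x →L[ℝ] TangentSpace I x => L (X x)) this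

section Riemannian

variable [RiemannianBundle (fun y : N => TangentSpace I' y)]

variable [IsManifold I' ∞ N]
  [IsContMDiffRiemannianBundle I' ∞ E' (fun y : N => TangentSpace I' y)]

theorem IsRiemannianSubmersion.mdifferentiable_horPart {F : M → N}
    (hF : IsRiemannianSubmersion I I' F) {X : Π x : M, TangentSpace I x} (hX : MDiff (T% X)) :
    MDiff (T% (horPart I I' F X)) := by
  intro x
  refine mdifferentiableAt_of_inner fun W hW => ?_
  simp only [hF.inner_horPart]
  have hT : MDiff (tangentMap I I' F) :=
    (hF.contMDiff.contMDiff_tangentMap (m := 1)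
      (one_add_one_eq_two.trans_le ENat.LEInfty.out)).mdifferentiable one_ne_zero
  exact MDifferentiableAt.inner_bundle (F := E') (E := fun y : N => TangentSpace I' y) (b := F)
    ((hT _).comp x hW) ((hT _).comp x (hX x))

theorem IsRiemannianSubmersion.mdifferentiable_vertPart {F : M → N}
    (hF : IsRiemannianSubmersion I I' F) {X : Π x : M, TangentSpace I x} (hX : MDiff (T% X)) :
    MDiff (T% (vertPart I I' F X)) := by
  have h : vertPart I I' F X = X - horPart I I' F X :=
    eq_sub_of_add_eq (vertPart_add_horPart F X)
  rw [h]
  exact mdifferentiable_sub_section hX (hF.mdifferentiable_horPart hX)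

/-- For `X` and `Y` horizontal, the vertical part of `∇_X JY`. -/
theorem IsRiemannianSubmersion.vertPart_nabla_bOp_add {F : M → N}
    (hF : IsRiemannianSubmersion I I' F) {J : Π x : M, TangentSpace I x →L[ℝ] TangentSpace I x}
    (hJ : IsAlmostHermitian J) {X Y : Π x : M, TangentSpace I x}
    (hX : ∀ x, X x ∈ horizontal I I' F x) (hY : ∀ x, Y x ∈ horizontal I I' F x)
    (hYs : CMDiff ∞ (T% Y)) :
    vertPart I I' F (nabla X (bOp I I' F J Y)) + oneillA I I' F X (cOp I I' F J Y) =
      vertPart I I' F (nabla X (applyJ J Y)) := by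
  have hJY : MDiff (T% (applyJ J Y)) := (hJ.contMDiff_applyJ hYs).mdifferentiable (by simp)
  rw [bOp, cOp, oneillA, horPart_eq_self hX, horPart_eq_self hY,
    vertPart_eq_zero (horPart_mem F _), nabla_zero, horPart_eq_self (horPart_mem F _),
    horPart_eq_zero (X := 0) (fun x => Submodule.zero_mem _), zero_add]
  conv_rhs => rw [← vertPart_add_horPart (I' := I') F (applyJ J Y),
    nabla_add _ (hF.mdifferentiable_vertPart hJY) (hF.mdifferentiable_horPart hJY)]
  exact (vertPart_add _ _ _).symm

/-- For `X` and `Y` horizontal, the horizontal part of `∇_X JY`. -/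
theorem IsRiemannianSubmersion.oneillA_bOp_add_horPart {F : M → N}
    (hF : IsRiemannianSubmersion I I' F) {J : Π x : M, TangentSpace I x →L[ℝ] TangentSpace I x}
    (hJ : IsAlmostHermitian J) {X Y : Π x : M, TangentSpace I x}
    (hX : ∀ x, X x ∈ horizontal I I' F x) (hY : ∀ x, Y x ∈ horizontal I I' F x)
    (hYs : CMDiff ∞ (T% Y)) :
    oneillA I I' F X (bOp I I' F J Y) + horPart I I' F (nabla X (cOp I I' F J Y)) =
      horPart I I' F (nabla X (applyJ J Y)) := by
  have hJY : MDiff (T% (applyJ J Y)) := (hJ.contMDiff_applyJ hYs).mdifferentiable (by simp)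
  rw [bOp, cOp, oneillA, horPart_eq_self hX, horPart_eq_self hY,
    horPart_eq_zero (vertPart_mem F _), nabla_zero, vertPart_eq_self (vertPart_mem F _),
    vertPart_eq_zero (X := 0) (fun x => Submodule.zero_mem _), add_zero]
  conv_rhs => rw [← vertPart_add_horPart (I' := I') F (applyJ J Y),
    nabla_add _ (hF.mdifferentiable_vertPart hJY) (hF.mdifferentiable_horPart hJY)]
  exact (horPart_add _ _ _).symm

end Riemannian

/-- A distribution closed under `∇` is involutive, since `∇` is torsion-free. -/
theorem definesTotallyGeodesicFoliation_iff {D : Π x : M, Submodule ℝ (TangentSpace I x)} :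
    DefinesTotallyGeodesicFoliation D ↔
      ∀ X Y : Π x : M, TangentSpace I x, IsSectionOf D X → IsSectionOf D Y →
        ∀ x, nabla X Y x ∈ D x := by
  refine ⟨fun h => h.totallyGeodesic, fun h => ⟨fun X Y hX hY x => ?_, h⟩⟩
  rw [← leviCivita_torsion_free X Y x (hX.1.mdifferentiable (by simp) x)
    (hY.1.mdifferentiable (by simp) x)]
  exact Submodule.sub_mem _ (h X Y hX hY x) (h Y X hY hX x)

end

/-- Let `F : M → N` be a v-semi-slant submersion from a Kähler manifold, with complex distribution
`D₁` and slant distribution `D₂`. Then `D₂` defines a totally geodesic foliation if and only if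
`φ(𝒱∇_X BY + 𝒜_X CY) + B(𝒜_X BY + ℋ∇_X CY) = 0` and
`P(ω(𝒱∇_X BY + 𝒜_X CY) + C(𝒜_X BY + ℋ∇_X CY)) = 0` for all `X, Y ∈ Γ(D₂)`, where `P` is the
orthogonal projection onto `D₁`. -/
theorem proposition3p14
    {E : Type*} [NormedAddCommGroup E] [NormedSpace ℝ E] [FiniteDimensional ℝ E]
    {H : Type*} [TopologicalSpace H] (I : ModelWithCorners ℝ E H)
    {M : Type*} [TopologicalSpace M] [ChartedSpace H M] [IsManifold I ∞ M]
    [BoundarylessManifold I M] [T2Space M] [SecondCountableTopology M]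
    [RiemannianBundle (fun x : M => TangentSpace I x)]
    [IsContMDiffRiemannianBundle I ∞ E (fun x : M => TangentSpace I x)]
    {E' : Type*} [NormedAddCommGroup E'] [NormedSpace ℝ E'] [FiniteDimensional ℝ E']
    {H' : Type*} [TopologicalSpace H'] (I' : ModelWithCorners ℝ E' H')
    {N : Type*} [TopologicalSpace N] [ChartedSpace H' N] [IsManifold I' ∞ N]
    [BoundarylessManifold I' N] [T2Space N] [SecondCountableTopology N]
    [RiemannianBundle (fun y : N => TangentSpace I' y)]
    [IsContMDiffRiemannianBundle I' ∞ E' (fun y : N => TangentSpace I' y)]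
    (J : Π x : M, TangentSpace I x →L[ℝ] TangentSpace I x) (hJ : IsKahler J)
    (F : M → N) (D₁ : Π x : M, Submodule ℝ (TangentSpace I x))
    (hF : IsVSemiSlantSubmersion I I' F J D₁) :
    DefinesTotallyGeodesicFoliation (slantDistribution I I' F D₁) ↔
      ∀ X Y : Π x : M, TangentSpace I x,
        IsSectionOf (slantDistribution I I' F D₁) X →
        IsSectionOf (slantDistribution I I' F D₁) Y →
        phiOp I I' F J
            (vertPart I I' F (nabla X (bOp I I' F J Y)) + oneillA I I' F X (cOp I I' F J Y))
          + bOp I I' F J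
            (oneillA I I' F X (bOp I I' F J Y) + horPart I I' F (nabla X (cOp I I' F J Y))) = 0 ∧
        projOnto D₁
          (omegaOp I I' F J
            (vertPart I I' F (nabla X (bOp I I' F J Y)) + oneillA I I' F X (cOp I I' F J Y))
          + cOp I I' F J
            (oneillA I I' F X (bOp I I' F J Y) + horPart I I' F (nabla X (cOp I I' F J Y)))) = 0 := by
  rw [definesTotallyGeodesicFoliation_iff]
  refine forall_congr' fun X => forall_congr' fun Y => forall_congr' fun hX =>
    forall_congr' fun hY => ?_
  have hXh : ∀ x, X x ∈ horizontal I I' F x := fun x => (hX.2 x).2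
  have hYh : ∀ x, Y x ∈ horizontal I I' F x := fun x => (hY.2 x).2
  have hJJ : applyJ J (applyJ J (nabla X Y)) = -nabla X Y :=
    funext fun x => hJ.apply_apply x (nabla X Y x)
  rw [hF.vertPart_nabla_bOp_add hJ.toIsAlmostHermitian hXh hYh hY.1,
    hF.oneillA_bOp_add_horPart hJ.toIsAlmostHermitian hXh hYh hY.1,
    hJ.parallel X Y hX.1 hY.1, phiOp_add_bOp, omegaOp_add_cOp, hJJ,
    projOnto_horPart hF.le_horizontal, vertPart, projOnto_neg, projOnto_neg, neg_eq_zero,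
    neg_eq_zero]
  exact mem_slantDistribution_iff _
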